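/- Let $\mu$ be a measure on a measurable space, let $p(\cdot;\beta)\ge 0$ be a family of $\mu$-integrable functions whose parameter $\beta$ ranges over a neighbourhood in a Euclidean space of the true value $\beta^*$, and let the data density be $p_d=p(\cdot;\beta^*)$, with $\int p_d\,d\mu=1$. The model is either \emph{normalized}, $\beta=\theta\in\mathbb R^d$ and $\int p(x;\beta)\,d\mu(x)=1$ for all $\beta$, with differentiation of this integral at $\beta^*$ under the integral sign justified by the usual domination condition $|p(x;\beta)-p(x;\beta^*)|\le g(x)\|\beta-\beta^*\|$, $g\in L^1(\mu)$; or \emph{unnormalized}, $\beta=(\theta,c)\in\mathbb R^d\times\mathbb R$ and $p(x;(\theta,c))=q(x;\theta)e^{-c}$. Assume that $\beta\mapsto p(x;\beta)$ is differentiable at $\beta^*$ for $\mu$-almost every $x$, write $\psi(x)=\nabla_\beta\log p(x;\beta^*)$ for the (generalized) score, and assume that $\mathbb E_{p_d}\|\psi\|^2<\infty$ and that $I=\mathbb E_{p_d}[\psi\psi^\top]$ is invertible. For a total budget $T>0$ of observations, a noise-data ratio $\nu>0$ and a noise density $p_n$, put $w=\nu p_n/(p_d+\nu p_n)$, $m_w=\mathbb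 E_{p_d}[w\psi]$, $I_w=\mathbb E_{p_d}[w\psi\psi^\top]$; the (asymptotic) mean-squared error of noise-contrastive estimation is $$\mathrm{MSE}(T,\nu,p_n)=\frac{\nu+1}{T}\,\mathrm{tr}\Big(I_w^{-1}-\frac{\nu+1}{\nu}\,I_w^{-1}m_wm_w^\top I_w^{-1}\Big).$$ Let $w_1(x)=\|I^{-1}\psi(x)\|$ and $p_n^{\mathrm{opt}}=p_dw_1/\int p_dw_1\,d\mu$. Then, for every fixed $T>0$, for normalized and for unnormalized models, $$\lim_{\nu\to\infty}\big(\mathrm{MSE}(T,\nu,p_d)-\mathrm{MSE}(T,\nu,p_n^{\mathrm{opt}})\big)=\frac1T\,\mathrm{Var}_{x\sim p_d}\big(w_1(x)\big).$$ Furthermore, for normalized models, with the Cramér–Rao value $\mathrm{MSE}_{\mathrm{CR}}(T,\nu)=\frac1{T_d}\mathrm{tr}(I^{-1})$ for the $T_d=T/(\nu+1)$ data observations, $$\lim_{\nu\to\infty}\big(\mathrm{MSE}(T,\nu,p_n^{\mathrm{opt}})-\mathrm{MSE}_{\mathrm{CR}}(T,\nu)\big)=\frac1T\big(\mathbb E_{x\sim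 p_d}\|I^{-1}\psi(x)\|\big)^2.$$ -/

import Mathlib

open MeasureTheory Filter Topology ProbabilityTheory
open scoped Matrix

namespace NCE

noncomputable section

/-- Parameter space: real vectors indexed by `ι`, with the Euclidean norm. -/
abbrev Param (ι : Type*) := EuclideanSpace ℝ ι

/-- The probability distribution with density `f` with respect to the base measure `μ`. -/
def law {X : Type*} [MeasurableSpace X] (μ : Measure X) (f : X → ℝ) : Measure X :=
  μ.withDensity fun x => ENNReal.ofReal (f x)

/-- The (generalized) Fisher score `∇_β log p(x; β)`. It equals the parameter gradient of the
classifier `F(x; β) = log (p(x; β) / (ν pₙ(x)))`. -/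
def score {X ι : Type*} [Fintype ι] (p : Param ι → X → ℝ) (β : Param ι) (x : X) : Param ι :=
  gradient (fun b => Real.log (p b x)) β

/-- The score mean `m_w = E_{x ∼ p_d} [w(x) ψ(x)]`, with `p_d = p β` and `ψ` the score at `β`. -/
def scoreMean {X ι : Type*} [MeasurableSpace X] [Fintype ι] (μ : Measure X)
    (p : Param ι → X → ℝ) (β : Param ι) (w : X → ℝ) : ι → ℝ :=
  fun i => ∫ x, w x * score p β x i ∂(law μ (p β))

/-- The matrix `I_w = E_{x ∼ p_d} [w(x) ψ(x) ψ(x)ᵀ]`, with `p_d = p β`. -/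
def scoreCov {X ι : Type*} [MeasurableSpace X] [Fintype ι] (μ : Measure X)
    (p : Param ι → X → ℝ) (β : Param ι) (w : X → ℝ) : Matrix ι ι ℝ :=
  Matrix.of fun i j => ∫ x, w x * score p β x i * score p β x j ∂(law μ (p β))

/-- The unweighted matrix `I = E_{x ∼ p_d} [ψ(x) ψ(x)ᵀ]`; for a normalized model this is the
Fisher information matrix. -/
def fisherInfo {X ι : Type*} [MeasurableSpace X] [Fintype ι] (μ : Measure X)
    (p : Param ι → X → ℝ) (β : Param ι) : Matrix ι ι ℝ :=
  scoreCov μ p β fun _ => 1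

/-- `P(Y = 0 | x) = ν pₙ(x) / (p_d(x) + ν pₙ(x))`: the posterior probability that `x` is noise,
which is the weight of the logistic classification loss. -/
def noisePosterior {X : Type*} (ν : ℝ) (pd pn : X → ℝ) (x : X) : ℝ :=
  ν * pn x / (pd x + ν * pn x)

/-- The (asymptotic) mean-squared error of noise-contrastive estimation at the true parameter
`β`, for a total budget of `T` observations, a noise-data ratio `ν` and noise density `pn`:
`(ν + 1) / T * tr (I_w⁻¹ - (ν + 1) / ν • I_w⁻¹ m_w m_wᵀ I_w⁻¹)`, with `w = P(Y = 0 | x)`. -/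
def mse {X ι : Type*} [MeasurableSpace X] [Fintype ι] [DecidableEq ι] (μ : Measure X)
    (p : Param ι → X → ℝ) (β : Param ι) (T ν : ℝ) (pn : X → ℝ) : ℝ :=
  let w := noisePosterior ν (p β) pn
  let Iw := scoreCov μ p β w
  let mw := scoreMean μ p β w
  (ν + 1) / T *
    Matrix.trace (Iw⁻¹ - ((ν + 1) / ν) • (Iw⁻¹ * Matrix.vecMulVec mw mw * Iw⁻¹))

/-- The Cramér–Rao mean-squared error `tr (I⁻¹) / T_d`, where `T_d = T / (ν + 1)` is the number
of data observations. -/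
def mseCramerRao {X ι : Type*} [MeasurableSpace X] [Fintype ι] [DecidableEq ι] (μ : Measure X)
    (p : Param ι → X → ℝ) (β : Param ι) (T ν : ℝ) : ℝ :=
  1 / (T / (ν + 1)) * Matrix.trace (fisherInfo μ p β)⁻¹

/-- The reweighting function `w₁(x) = ‖I⁻¹ ψ(x)‖`, i.e. the norm of the score in the metric
`I⁻²`. -/
def weightOne {X ι : Type*} [MeasurableSpace X] [Fintype ι] [DecidableEq ι] (μ : Measure X)
    (p : Param ι → X → ℝ) (β : Param ι) (x : X) : ℝ :=
  ‖(WithLp.toLp 2 ((fisherInfo μ p β)⁻¹ *ᵥ (score p β x).ofLp) : Param ι)‖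

/-- The normalized product `f • g = f g / ∫ f g` of two functions. -/
def normalizedProduct {X : Type*} [MeasurableSpace X] (μ : Measure X) (f g : X → ℝ) (x : X) : ℝ :=
  f x * g x / ∫ y, f y * g y ∂μ

/-- The optimal noise density `p_d • w₁`. -/
def optimalNoise {X ι : Type*} [MeasurableSpace X] [Fintype ι] [DecidableEq ι] (μ : Measure X)
    (p : Param ι → X → ℝ) (β : Param ι) : X → ℝ :=
  normalizedProduct μ (p β) (weightOne μ p β)

/-- The standing assumptions for a parametric model `p`, possibly unnormalized, whose parameter
ranges over a neighbourhood `Θ` of the true value `β`: the data density is `p β`, the score at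
`β` exists and has a finite and invertible second moment matrix. -/
structure IsModel {X ι : Type*} [MeasurableSpace X] [Fintype ι] [DecidableEq ι] (μ : Measure X)
    (Θ : Set (Param ι)) (p : Param ι → X → ℝ) (β : Param ι) : Prop where
  mem_nhds : Θ ∈ 𝓝 β
  nonneg : ∀ b ∈ Θ, ∀ x, 0 ≤ p b x
  integrable : ∀ b ∈ Θ, Integrable (p b) μ
  integral_data : ∫ x, p β x ∂μ = 1
  differentiable : ∀ᵐ x ∂μ, DifferentiableAt ℝ (fun b => p b x) β
  finite_info : Integrable (fun x => ‖score p β x‖ ^ 2) (law μ (p β))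
  invertible_info : IsUnit (fisherInfo μ p β).det

/-- A normalized model: every `p b` is a probability density. The last field is the usual
domination condition for differentiating `∫ p b` under the integral sign at `b = β`. -/
structure IsNormalizedModel {X ι : Type*} [MeasurableSpace X] [Fintype ι] [DecidableEq ι]
    (μ : Measure X) (Θ : Set (Param ι)) (p : Param ι → X → ℝ) (β : Param ι) : Prop
    extends IsModel μ Θ p β where
  normalized : ∀ b ∈ Θ, ∫ x, p b x ∂μ = 1
  dominated : ∃ g : X → ℝ, Integrable g μ ∧
    ∀ᵐ x ∂μ, ∀ b ∈ Θ, |p b x - p β x| ≤ g x * ‖b - β‖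

/-- The unnormalized (energy-based) model with a free log-normalization constant: the parameter
is `β = (θ, c)` and `p(x; (θ, c)) = q(x; θ) / exp c`. -/
def unnormalized {X κ : Type*} (q : Param κ → X → ℝ) (β : Param (κ ⊕ Unit)) (x : X) : ℝ :=
  q (WithLp.toLp 2 fun k => β (Sum.inl k)) x / Real.exp (β (Sum.inr ()))

end

end NCE

/-!
If the noise density is `p_d g`, the weight is `w = ν g / (1 + ν g)`, so `1 - w = 1 / (1 + ν g)` is
asymptotically `g⁻¹ / ν` and every weighted moment satisfies `E[f] - E[w f] ≈ E[f / g] / ν`.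
Since `I_w⁻¹ m_w` solves a linear system, a first-order perturbation of that system and of the
inverse `I_w⁻¹` expands the mean-squared error: its leading part depends on `I` and `m` only, and
the next term is `E[w₁² / g] / T` plus a correction coming from the mean score. The noise `p_d` is
`g = 1`, with value `E[w₁²]`; the optimal noise is `g = w₁ / E[w₁]`, with value `E[w₁]²`; the
difference is the variance of `w₁`. The correction vanishes for `g = 1`. For the optimal noise it
vanishes if the score has mean zero (normalized models) and also if the constant functions are
linear combinations of the score (unnormalized models, where the `c`-component of the score is
`-1`).
-/

namespace NCE

section Perturbation

variable {α n : Type*} [Fintype n] {l : Filter α} {r : α → ℝ}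

lemma tendsto_of_tendsto_smul_sub {E : Type*} [AddCommGroup E] [Module ℝ E] [TopologicalSpace E]
    [IsTopologicalAddGroup E] [ContinuousSMul ℝ E] {u : α → E} {x d : E}
    (hr : Tendsto r l atTop) (h : Tendsto (fun a => r a • (x - u a)) l (𝓝 d)) :
    Tendsto u l (𝓝 x) := by
  have h0 := tendsto_const_nhds (x := x).sub ((tendsto_inv_atTop_zero.comp hr).smul h)
  rw [zero_smul, sub_zero] at h0
  refine h0.congr' ?_
  filter_upwards [hr.eventually_ne_atTop 0] with a ha
  rw [Function.comp_apply, inv_smul_smul₀ ha, sub_sub_cancel]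

lemma tendsto_dotProduct {u u' : α → n → ℝ} {v v' : n → ℝ} (hu : Tendsto u l (𝓝 v))
    (hu' : Tendsto u' l (𝓝 v')) : Tendsto (fun a => u a ⬝ᵥ u' a) l (𝓝 (v ⬝ᵥ v')) :=
  tendsto_finsetSum _ fun i _ => (hu.apply_nhds i).mul (hu'.apply_nhds i)

lemma tendsto_mulVec {S : α → Matrix n n ℝ} {A : Matrix n n ℝ} {u : α → n → ℝ} {v : n → ℝ}
    (hS : Tendsto S l (𝓝 A)) (hu : Tendsto u l (𝓝 v)) :
    Tendsto (fun a => S a *ᵥ u a) l (𝓝 (A *ᵥ v)) :=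
  tendsto_pi_nhds.2 fun i => tendsto_dotProduct (hS.apply_nhds i) hu

lemma tendsto_mul_dotProduct_self_sub {u : α → n → ℝ} {v d : n → ℝ} (hr : Tendsto r l atTop)
    (h : Tendsto (fun a => r a • (v - u a)) l (𝓝 d)) :
    Tendsto (fun a => r a * (v ⬝ᵥ v - u a ⬝ᵥ u a)) l (𝓝 (2 * (v ⬝ᵥ d))) := by
  have hsum : Tendsto (fun a => v + u a) l (𝓝 (v + v)) :=
    (tendsto_of_tendsto_smul_sub hr h).const_add v
  have hlim := tendsto_dotProduct hsum h
  rw [add_dotProduct, ← two_mul] at hlim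
  refine hlim.congr fun a => ?_
  rw [dotProduct_smul, smul_eq_mul, add_dotProduct, dotProduct_sub, dotProduct_sub,
    dotProduct_comm (u a) v]
  ring

variable [DecidableEq n] {A D : Matrix n n ℝ} {S : α → Matrix n n ℝ}

lemma tendsto_matrix_inv (hA : IsUnit A.det) (hS : Tendsto S l (𝓝 A)) :
    Tendsto (fun a => (S a)⁻¹) l (𝓝 A⁻¹) := by
  refine (continuousAt_matrix_inv A ?_).tendsto.comp hS
  simpa only [Ring.inverse_eq_inv'] using continuousAt_inv₀ hA.ne_zero

lemma eventually_isUnit_det (hA : IsUnit A.det) (hS : Tendsto S l (𝓝 A)) :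
    ∀ᶠ a in l, IsUnit (S a).det :=
  ((((continuous_id.matrix_det).tendsto A).comp hS).eventually_ne hA.ne_zero).mono
    fun _ ha => ha.isUnit

lemma tendsto_smul_inv_sub_inv (hA : IsUnit A.det) (hr : Tendsto r l atTop)
    (hS : Tendsto (fun a => r a • (A - S a)) l (𝓝 D)) :
    Tendsto (fun a => r a • ((S a)⁻¹ - A⁻¹)) l (𝓝 (A⁻¹ * D * A⁻¹)) := by
  have hSA := tendsto_of_tendsto_smul_sub hr hS
  refine (((tendsto_matrix_inv hA hSA).mul hS).mul_const A⁻¹).congr' ?_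
  filter_upwards [eventually_isUnit_det hA hSA] with a ha
  rw [Matrix.mul_smul, Matrix.smul_mul, mul_sub, sub_mul, Matrix.nonsing_inv_mul _ ha, one_mul,
    Matrix.mul_assoc, Matrix.mul_nonsing_inv _ hA, mul_one]

lemma tendsto_smul_inv_mulVec_sub {u : α → n → ℝ} {v d : n → ℝ} (hA : IsUnit A.det)
    (hr : Tendsto r l atTop) (hS : Tendsto (fun a => r a • (A - S a)) l (𝓝 D))
    (hu : Tendsto (fun a => r a • (v - u a)) l (𝓝 d)) :
    Tendsto (fun a => r a • (A⁻¹ *ᵥ v - (S a)⁻¹ *ᵥ u a)) l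
      (𝓝 (A⁻¹ *ᵥ (d - D *ᵥ (A⁻¹ *ᵥ v)))) := by
  have hSA := tendsto_of_tendsto_smul_sub hr hS
  refine (tendsto_mulVec (tendsto_matrix_inv hA hSA)
    (hu.sub (tendsto_mulVec hS tendsto_const_nhds))).congr' ?_
  filter_upwards [eventually_isUnit_det hA hSA] with a ha
  have hv : A *ᵥ (A⁻¹ *ᵥ v) = v := by
    rw [Matrix.mulVec_mulVec, Matrix.mul_nonsing_inv _ hA, Matrix.one_mulVec]
  rw [Matrix.smul_mulVec, ← smul_sub, Matrix.mulVec_smul, Matrix.sub_mulVec, hv,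
    sub_sub_sub_cancel_left, Matrix.mulVec_sub, Matrix.mulVec_mulVec _ (S a)⁻¹ (S a),
    Matrix.nonsing_inv_mul _ ha, Matrix.one_mulVec]

end Perturbation

section NoiseWeight

lemma one_sub_noisePosterior_mul {X : Type*} {pd g : X → ℝ} {ν : ℝ} {x : X} (hpd : pd x ≠ 0)
    (hg : 1 + ν * g x ≠ 0) :
    1 - noisePosterior ν pd (fun y => pd y * g y) x = (1 + ν * g x)⁻¹ := by
  have hden : pd x + ν * (pd x * g x) = pd x * (1 + ν * g x) := by ring
  rw [noisePosterior, hden]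
  field_simp
  ring

lemma tendsto_add_one_mul_inv_one_add_mul {a : ℝ} (ha : a ≠ 0) :
    Tendsto (fun ν : ℝ => (ν + 1) * (1 + ν * a)⁻¹) atTop (𝓝 a⁻¹) := by
  have hinv := tendsto_inv_atTop_zero (𝕜 := ℝ)
  have hlim : Tendsto (fun ν : ℝ => (1 + ν⁻¹) * (ν⁻¹ + a)⁻¹) atTop (𝓝 ((1 + 0) * (0 + a)⁻¹)) :=
    (hinv.const_add 1).mul ((hinv.add_const a).inv₀ (by simpa using ha))
  rw [add_zero, zero_add, one_mul] at hlim
  refine hlim.congr' ?_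
  filter_upwards [eventually_gt_atTop 0] with ν hν
  have hden : 1 + ν * a = ν * (ν⁻¹ + a) := by field_simp
  rw [hden, mul_inv]
  field_simp

lemma add_one_mul_inv_one_add_mul_le {a ν : ℝ} (ha : 0 < a) (hν : 1 ≤ ν) :
    (ν + 1) * (1 + ν * a)⁻¹ ≤ 2 * a⁻¹ := by
  have hden : 0 < 1 + ν * a := by positivity
  rw [← div_eq_mul_inv, ← div_eq_mul_inv, div_le_div_iff₀ hden ha]
  nlinarith

lemma tendsto_add_one_mul_integral_inv_one_add_mul {X : Type*} [MeasurableSpace X]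
    {P : Measure X} {f g : X → ℝ} (hg0 : ∀ x, 0 ≤ g x) (hg : AEMeasurable g P)
    (hf : AEMeasurable f P) (hgf : Integrable (fun x => (g x)⁻¹ * f x) P)
    (hf0 : ∀ᵐ x ∂P, g x = 0 → f x = 0) :
    Tendsto (fun ν : ℝ => (ν + 1) * ∫ x, (1 + ν * g x)⁻¹ * f x ∂P) atTop
      (𝓝 (∫ x, (g x)⁻¹ * f x ∂P)) := by
  simp_rw [← integral_const_mul]
  refine tendsto_integral_filter_of_dominated_convergence (fun x => 2 * ‖(g x)⁻¹ * f x‖) ?_ ?_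
    (hgf.norm.const_mul 2) ?_
  · filter_upwards with ν
    exact ((((hg.const_mul ν).const_add 1).inv.mul hf).const_mul _).aestronglyMeasurable
  · filter_upwards [eventually_ge_atTop 1] with ν hν
    filter_upwards [hf0] with x hfx
    rcases (hg0 x).eq_or_lt with hx | hx
    · simp [hfx hx.symm]
    · have hw0 : 0 ≤ (ν + 1) * (1 + ν * g x)⁻¹ := by positivity
      rw [← mul_assoc, norm_mul _ (f x), norm_mul _ (f x), Real.norm_of_nonneg hw0,
        Real.norm_of_nonneg (inv_nonneg.2 hx.le), ← mul_assoc]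
      exact mul_le_mul_of_nonneg_right (add_one_mul_inv_one_add_mul_le hx hν) (norm_nonneg _)
  · filter_upwards [hf0] with x hfx
    by_cases hx : g x = 0
    · simp [hfx hx]
    · simp_rw [← mul_assoc]
      exact (tendsto_add_one_mul_inv_one_add_mul hx).mul_const _

lemma tendsto_add_one_mul_integral_sub_integral_noisePosterior {X : Type*} [MeasurableSpace X]
    {P : Measure X} {f g pd : X → ℝ} (hpd : ∀ᵐ x ∂P, pd x ≠ 0) (hg0 : ∀ x, 0 ≤ g x)
    (hg : AEMeasurable g P) (hf : Integrable f P)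
    (hgf : Integrable (fun x => (g x)⁻¹ * f x) P) (hf0 : ∀ᵐ x ∂P, g x = 0 → f x = 0) :
    Tendsto (fun ν : ℝ => (ν + 1) *
        (∫ x, f x ∂P - ∫ x, noisePosterior ν pd (fun y => pd y * g y) x * f x ∂P)) atTop
      (𝓝 (∫ x, (g x)⁻¹ * f x ∂P)) := by
  refine (tendsto_add_one_mul_integral_inv_one_add_mul hg0 hg hf.aemeasurable hgf hf0).congr' ?_
  filter_upwards [eventually_ge_atTop 0] with ν hν
  have hden (x : X) : 1 ≤ 1 + ν * g x := le_add_of_nonneg_right (mul_nonneg hν (hg0 x))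
  have hint : Integrable (fun x => (1 + ν * g x)⁻¹ * f x) P := by
    refine hf.bdd_mul (c := 1) ((hg.const_mul ν).const_add 1).inv.aestronglyMeasurable
      (ae_of_all _ fun x => ?_)
    rw [Real.norm_of_nonneg (inv_nonneg.2 (zero_le_one.trans (hden x)))]
    exact inv_le_one_of_one_le₀ (hden x)
  have hposterior : ∫ x, noisePosterior ν pd (fun y => pd y * g y) x * f x ∂P =
      ∫ x, (f x - (1 + ν * g x)⁻¹ * f x) ∂P := by
    refine integral_congr_ae ?_
    filter_upwards [hpd] with x hx
    rw [← one_sub_noisePosterior_mul hx (zero_lt_one.trans_le (hden x)).ne']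
    ring
  rw [hposterior, integral_sub hf hint, sub_sub_cancel]

end NoiseWeight

section Law

variable {X : Type*} [MeasurableSpace X] {μ : Measure X} {f : X → ℝ}

lemma law_absolutelyContinuous : law μ f ≪ μ := withDensity_absolutelyContinuous _ _

lemma ae_law_pos (hf : AEMeasurable f μ) : ∀ᵐ x ∂law μ f, 0 < f x := by
  rw [law, ae_withDensity_iff' hf.ennreal_ofReal]
  filter_upwards with x hx
  simpa using hx

lemma integral_law {E : Type*} [NormedAddCommGroup E] [NormedSpace ℝ E] (hf : AEMeasurable f μ)
    (hf0 : ∀ x, 0 ≤ f x) (φ : X → E) : ∫ x, φ x ∂law μ f = ∫ x, f x • φ x ∂μ := by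
  rw [law, integral_withDensity_eq_integral_toReal_smul₀ hf.ennreal_ofReal (by simp)]
  simp_rw [ENNReal.toReal_ofReal (hf0 _)]

lemma integrable_law_iff {E : Type*} [NormedAddCommGroup E] [NormedSpace ℝ E]
    (hf : AEMeasurable f μ) (hf0 : ∀ x, 0 ≤ f x) {φ : X → E} :
    Integrable φ (law μ f) ↔ Integrable (fun x => f x • φ x) μ := by
  rw [law, integrable_withDensity_iff_integrable_smul₀' hf.ennreal_ofReal (by simp)]
  simp_rw [ENNReal.toReal_ofReal (hf0 _)]

lemma isProbabilityMeasure_law (hf : Integrable f μ) (hf0 : ∀ x, 0 ≤ f x)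
    (hf1 : ∫ x, f x ∂μ = 1) : IsProbabilityMeasure (law μ f) := by
  refine ⟨?_⟩
  rw [law, withDensity_apply _ MeasurableSet.univ, Measure.restrict_univ,
    ← ofReal_integral_eq_lintegral_ofReal hf (ae_of_all _ hf0), hf1, ENNReal.ofReal_one]

end Law

section Gradient

lemma hasDerivAt_add_smul_single_of_hasGradientAt {ι : Type*} [Fintype ι] [DecidableEq ι]
    {f : Param ι → ℝ} {v β : Param ι} (hf : HasGradientAt f v β) (i : ι) :
    HasDerivAt (fun t : ℝ => f (β + t • EuclideanSpace.single i 1)) (v i) 0 := by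
  simpa [HasLineDerivAt, EuclideanSpace.inner_single_right] using
    hf.hasFDerivAt.hasLineDerivAt (EuclideanSpace.single i 1)

variable {E : Type*} [NormedAddCommGroup E] [InnerProductSpace ℝ E] [CompleteSpace E]

lemma hasGradientAt_smul_gradient_log {f : E → ℝ} {β : E} (hf : DifferentiableAt ℝ f β)
    (hf0 : ∀ᶠ b in 𝓝 β, 0 ≤ f b) :
    HasGradientAt f (f β • gradient (fun b => Real.log (f b)) β) β := by
  rw [hasGradientAt_iff_hasFDerivAt, map_smul]
  rcases hf0.self_of_nhds.eq_or_lt with h0 | h0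
  -- at a zero of `f`, which is a minimum, both sides vanish
  · have hmin : IsLocalMin f β := by simpa only [IsLocalMin, IsMinFilter, ← h0] using hf0
    simpa only [← h0, zero_smul, hmin.fderiv_eq_zero] using hf.hasFDerivAt
  · have hlog := (hf.log h0.ne').hasGradientAt.hasFDerivAt
    rw [hlog.unique (hf.hasFDerivAt.log h0.ne'), smul_inv_smul₀ h0.ne']
    exact hf.hasFDerivAt

lemma hasGradientAt_integral_of_dominated {X : Type*} [MeasurableSpace X] {μ : Measure X}
    {Θ : Set E} {F : E → X → ℝ} {v : X → E} {g : X → ℝ} {β : E} (hΘ : Θ ∈ 𝓝 β)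
    (hF : ∀ b ∈ Θ, Integrable (F b) μ) (hv : Integrable v μ) (hg : Integrable g μ)
    (hFg : ∀ᵐ x ∂μ, ∀ b ∈ Θ, |F b x - F β x| ≤ g x * ‖b - β‖)
    (hFv : ∀ᵐ x ∂μ, HasGradientAt (fun b => F b x) (v x) β) :
    HasGradientAt (fun b => ∫ x, F b x ∂μ) (∫ x, v x ∂μ) β := by
  have hderiv := (hasFDerivAt_integral_of_dominated_loc_of_lip' hΘ
    (fun b hb => (hF b hb).aestronglyMeasurable) (hF β (mem_of_mem_nhds hΘ))
    ((innerSL ℝ).continuous.comp_aestronglyMeasurable hv.aestronglyMeasurable) hFg hg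
    (hFv.mono fun x hx => hx.hasFDerivAt)).2
  rwa [ContinuousLinearMap.integral_comp_comm _ hv] at hderiv

end Gradient

section Model

variable {X ι : Type*} [MeasurableSpace X] [Fintype ι] {μ : Measure X} {Θ : Set (Param ι)}
  {p : Param ι → X → ℝ} {β : Param ι}

lemma transpose_scoreCov (w : X → ℝ) : (scoreCov μ p β w)ᵀ = scoreCov μ p β w := by
  ext i j
  simp [scoreCov, mul_right_comm]

lemma trace_mul_scoreCov (G : Matrix ι ι ℝ) {w : X → ℝ}
    (hw : ∀ i j, Integrable (fun x => w x * (score p β x i * score p β x j)) (law μ (p β))) :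
    (G * scoreCov μ p β w).trace =
      ∫ x, w x * ((score p β x).ofLp ⬝ᵥ G *ᵥ (score p β x).ofLp) ∂law μ (p β) := by
  have hexpand (x : X) : w x * ((score p β x).ofLp ⬝ᵥ G *ᵥ (score p β x).ofLp) =
      ∑ i, ∑ j, G i j * (w x * (score p β x j * score p β x i)) := by
    simp only [dotProduct, Matrix.mulVec, Finset.mul_sum]
    exact Finset.sum_congr rfl fun i _ => Finset.sum_congr rfl fun j _ => by ring
  have hint (i j : ι) := (hw j i).const_mul (G i j)
  simp_rw [hexpand]
  rw [integral_finsetSum _ fun i _ => integrable_finsetSum _ fun j _ => hint i j]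
  refine Finset.sum_congr rfl fun i _ => ?_
  rw [integral_finsetSum _ fun j _ => hint i j]
  refine Finset.sum_congr rfl fun j _ => ?_
  simp_rw [integral_const_mul, scoreCov, Matrix.of_apply, mul_assoc]

variable [DecidableEq ι]

lemma weightOne_eq_norm_toEuclideanCLM (x : X) :
    weightOne μ p β x =
      ‖Matrix.toEuclideanCLM (𝕜 := ℝ) (fisherInfo μ p β)⁻¹ (score p β x)‖ := rfl

lemma weightOne_nonneg (x : X) : 0 ≤ weightOne μ p β x := norm_nonneg _

lemma weightOne_sq (x : X) :
    weightOne μ p β x ^ 2 = (score p β x).ofLp ⬝ᵥ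
      ((fisherInfo μ p β)⁻¹ * (fisherInfo μ p β)⁻¹) *ᵥ (score p β x).ofLp := by
  have hsymm : (fisherInfo μ p β)⁻¹ᵀ = (fisherInfo μ p β)⁻¹ := by
    rw [Matrix.transpose_nonsing_inv, fisherInfo, transpose_scoreCov]
  rw [weightOne, EuclideanSpace.real_norm_sq_eq, ← Matrix.mulVec_mulVec, Matrix.dotProduct_mulVec,
    ← Matrix.mulVec_transpose, hsymm]
  simp only [dotProduct, sq]

lemma trace_inv_mul_scoreCov_mul_inv {w : X → ℝ}
    (hw : ∀ i j, Integrable (fun x => w x * (score p β x i * score p β x j)) (law μ (p β))) :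
    ((fisherInfo μ p β)⁻¹ * scoreCov μ p β w * (fisherInfo μ p β)⁻¹).trace =
      ∫ x, w x * weightOne μ p β x ^ 2 ∂law μ (p β) := by
  rw [Matrix.trace_mul_comm, ← Matrix.mul_assoc, trace_mul_scoreCov _ hw]
  simp_rw [weightOne_sq]

namespace IsModel

lemma nonneg_data (h : IsModel μ Θ p β) (x : X) : 0 ≤ p β x :=
  h.nonneg β (mem_of_mem_nhds h.mem_nhds) x

lemma integrable_data (h : IsModel μ Θ p β) : Integrable (p β) μ :=
  h.integrable β (mem_of_mem_nhds h.mem_nhds)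

lemma ae_pos (h : IsModel μ Θ p β) : ∀ᵐ x ∂law μ (p β), 0 < p β x :=
  ae_law_pos h.integrable_data.aemeasurable

lemma isProbabilityMeasure (h : IsModel μ Θ p β) : IsProbabilityMeasure (law μ (p β)) :=
  isProbabilityMeasure_law h.integrable_data h.nonneg_data h.integral_data

lemma ae_hasGradientAt_log (h : IsModel μ Θ p β) :
    ∀ᵐ x ∂law μ (p β), HasGradientAt (fun b => Real.log (p b x)) (score p β x) β := by
  filter_upwards [law_absolutelyContinuous.ae_le h.differentiable, h.ae_pos] with x hd hp
  exact (hd.log hp.ne').hasGradientAt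

-- The score is an a.e. limit of measurable difference quotients.
lemma aemeasurable_score_apply (h : IsModel μ Θ p β) (i : ι) :
    AEMeasurable (fun x => score p β x i) (law μ (p β)) := by
  let b (t : ℝ) : Param ι := β + t • EuclideanSpace.single i 1
  have hb : Tendsto b (𝓝[>] 0) (𝓝 β) := by
    have hcont : Continuous b := by fun_prop
    simpa [b] using (hcont.tendsto 0).mono_left nhdsWithin_le_nhds
  obtain ⟨t, ht, htΘ⟩ := exists_seq_forall_of_frequently (hb.eventually h.mem_nhds).frequently
  have hlog {b' : Param ι} (hb' : b' ∈ Θ) :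
      AEMeasurable (fun x => Real.log (p b' x)) (law μ (p β)) :=
    (h.integrable b' hb').aemeasurable.log.mono_ac law_absolutelyContinuous
  refine aemeasurable_of_tendsto_metrizable_ae atTop
    (f := fun n x => (t n)⁻¹ * (Real.log (p (b (t n)) x) - Real.log (p β x)))
    (fun n => ((hlog (htΘ n)).sub (hlog (mem_of_mem_nhds h.mem_nhds))).const_mul _) ?_
  filter_upwards [h.ae_hasGradientAt_log] with x hx
  have hslope := (hasDerivAt_add_smul_single_of_hasGradientAt hx i).tendsto_slope_zero_right
  simpa [b, Function.comp_def] using hslope.comp ht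

lemma memLp_score (h : IsModel μ Θ p β) : MemLp (score p β) 2 (law μ (p β)) :=
  (memLp_two_iff_integrable_sq_norm ((WithLp.measurable_toLp 2 (ι → ℝ)).comp_aemeasurable
    (aemeasurable_pi_lambda _ h.aemeasurable_score_apply)).aestronglyMeasurable).2 h.finite_info

lemma memLp_score_apply (h : IsModel μ Θ p β) (i : ι) :
    MemLp (fun x => score p β x i) 2 (law μ (p β)) :=
  (EuclideanSpace.proj i : Param ι →L[ℝ] ℝ).comp_memLp' h.memLp_score

lemma integrable_score (h : IsModel μ Θ p β) : Integrable (score p β) (law μ (p β)) := by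
  have := h.isProbabilityMeasure
  exact h.memLp_score.integrable one_le_two

lemma integrable_score_apply (h : IsModel μ Θ p β) (i : ι) :
    Integrable (fun x => score p β x i) (law μ (p β)) :=
  (EuclideanSpace.proj i : Param ι →L[ℝ] ℝ).integrable_comp h.integrable_score

lemma integrable_score_mul_score (h : IsModel μ Θ p β) (i j : ι) :
    Integrable (fun x => score p β x i * score p β x j) (law μ (p β)) :=
  (h.memLp_score_apply i).integrable_mul (h.memLp_score_apply j)

lemma memLp_weightOne (h : IsModel μ Θ p β) : MemLp (weightOne μ p β) 2 (law μ (p β)) :=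
  ((Matrix.toEuclideanCLM (𝕜 := ℝ) (fisherInfo μ p β)⁻¹).comp_memLp' h.memLp_score).norm

lemma integrable_weightOne (h : IsModel μ Θ p β) :
    Integrable (weightOne μ p β) (law μ (p β)) := by
  have := h.isProbabilityMeasure
  exact h.memLp_weightOne.integrable one_le_two

lemma norm_score_le (h : IsModel μ Θ p β) (x : X) :
    ‖score p β x‖ ≤
      ‖Matrix.toEuclideanCLM (𝕜 := ℝ) (fisherInfo μ p β)‖ * weightOne μ p β x := by
  have hscore : Matrix.toEuclideanCLM (𝕜 := ℝ) (fisherInfo μ p β)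
      (Matrix.toEuclideanCLM (𝕜 := ℝ) (fisherInfo μ p β)⁻¹ (score p β x)) = score p β x := by
    rw [← mul_apply_eq_comp, ← map_mul,
      Matrix.mul_nonsing_inv _ h.invertible_info, map_one, one_apply_eq_self]
  rw [weightOne_eq_norm_toEuclideanCLM]
  conv_lhs => rw [← hscore]
  exact ContinuousLinearMap.le_opNorm _ _

lemma score_eq_zero_of_weightOne_eq_zero (h : IsModel μ Θ p β) {x : X}
    (hx : weightOne μ p β x = 0) : score p β x = 0 := by
  simpa [hx] using h.norm_score_le x

end IsModel

/-- The coefficients `I_w⁻¹ m_w` of the regression of the constant `1` on the score in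
`L²(w p_d)`. They enter the mean-squared error through their squared norm, which is the trace of
`I_w⁻¹ m_w m_wᵀ I_w⁻¹`. -/
noncomputable def regressionCoeff (μ : Measure X) (p : Param ι → X → ℝ) (β : Param ι)
    (w : X → ℝ) : ι → ℝ :=
  (scoreCov μ p β w)⁻¹ *ᵥ scoreMean μ p β w

/-- For the noise density `p_d / w`, the term of the second-order coefficient of the mean-squared
error which comes from the mean score; the other one is `E[w ‖I⁻¹ψ‖²]`. It measures by how much the
regression coefficients of the constant `1`, taken with respect to `p_d`, fail the normal equations
with respect to `w p_d`. -/
noncomputable def meanCorrection (μ : Measure X) (p : Param ι → X → ℝ) (β : Param ι)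
    (w : X → ℝ) : ℝ :=
  let a := regressionCoeff μ p β fun _ => 1
  2 * (a ⬝ᵥ (fisherInfo μ p β)⁻¹ *ᵥ (scoreMean μ p β w - scoreCov μ p β w *ᵥ a))

/-- The leading part, as the noise-data ratio grows, of `T` times the mean-squared error. It does
not depend on the noise density. -/
noncomputable def leadingError (μ : Measure X) (p : Param ι → X → ℝ) (β : Param ι) (ν : ℝ) : ℝ :=
  let a := regressionCoeff μ p β fun _ => 1
  (ν + 1) * ((fisherInfo μ p β)⁻¹.trace - (ν + 1) / ν * (a ⬝ᵥ a))

lemma trace_inv_mul_vecMulVec_mul_inv (w : X → ℝ) :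
    ((scoreCov μ p β w)⁻¹ * Matrix.vecMulVec (scoreMean μ p β w) (scoreMean μ p β w) *
      (scoreCov μ p β w)⁻¹).trace = regressionCoeff μ p β w ⬝ᵥ regressionCoeff μ p β w := by
  rw [Matrix.mul_vecMulVec, Matrix.vecMulVec_mul, Matrix.trace_vecMulVec,
    ← Matrix.mulVec_transpose, Matrix.transpose_nonsing_inv, transpose_scoreCov, regressionCoeff]

lemma mul_mse {T : ℝ} (hT : T ≠ 0) (ν : ℝ) (pn : X → ℝ) :
    T * mse μ p β T ν pn =
      let w := noisePosterior ν (p β) pn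
      (ν + 1) * ((scoreCov μ p β w)⁻¹.trace -
        (ν + 1) / ν * (regressionCoeff μ p β w ⬝ᵥ regressionCoeff μ p β w)) := by
  rw [mse, Matrix.trace_sub, Matrix.trace_smul, trace_inv_mul_vecMulVec_mul_inv, smul_eq_mul,
    ← mul_assoc, mul_div_cancel₀ _ hT]

lemma mul_mseCramerRao {T : ℝ} (hT : T ≠ 0) (ν : ℝ) :
    T * mseCramerRao μ p β T ν = (ν + 1) * (fisherInfo μ p β)⁻¹.trace := by
  rw [mseCramerRao, one_div_div, ← mul_assoc, mul_div_cancel₀ _ hT]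

lemma regressionCoeff_eq_zero {w : X → ℝ} (hw : scoreMean μ p β w = 0) :
    regressionCoeff μ p β w = 0 := by
  rw [regressionCoeff, hw, Matrix.mulVec_zero]

lemma meanCorrection_eq_zero_of_scoreMean_one_eq_zero (hm : scoreMean μ p β (fun _ => 1) = 0)
    (w : X → ℝ) : meanCorrection μ p β w = 0 := by
  rw [meanCorrection, regressionCoeff_eq_zero hm, zero_dotProduct, mul_zero]

lemma leadingError_of_scoreMean_one_eq_zero (hm : scoreMean μ p β (fun _ => 1) = 0) (ν : ℝ) :
    leadingError μ p β ν = (ν + 1) * (fisherInfo μ p β)⁻¹.trace := by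
  rw [leadingError, regressionCoeff_eq_zero hm, zero_dotProduct, mul_zero, sub_zero]

lemma meanCorrection_eq_zero_of_scoreMean_eq {w : X → ℝ} (hI : IsUnit (fisherInfo μ p β).det)
    {a : ι → ℝ} (h1 : scoreMean μ p β (fun _ => 1) = fisherInfo μ p β *ᵥ a)
    (hw : scoreMean μ p β w = scoreCov μ p β w *ᵥ a) : meanCorrection μ p β w = 0 := by
  have ha : regressionCoeff μ p β (fun _ => 1) = a := by
    rw [regressionCoeff, h1, ← fisherInfo, Matrix.mulVec_mulVec, Matrix.nonsing_inv_mul _ hI,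
      Matrix.one_mulVec]
  rw [meanCorrection, ha, hw, sub_self, Matrix.mulVec_zero, dotProduct_zero, mul_zero]

lemma meanCorrection_one (hI : IsUnit (fisherInfo μ p β).det) :
    meanCorrection μ p β (fun _ => 1) = 0 := by
  have hnormal : scoreMean μ p β (fun _ => 1) =
      fisherInfo μ p β *ᵥ ((fisherInfo μ p β)⁻¹ *ᵥ scoreMean μ p β fun _ => 1) := by
    rw [Matrix.mulVec_mulVec, Matrix.mul_nonsing_inv _ hI, Matrix.one_mulVec]
  exact meanCorrection_eq_zero_of_scoreMean_eq hI hnormal hnormal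

end Model

section NoiseRatio

variable {X ι : Type*} [MeasurableSpace X] [Fintype ι] {μ : Measure X} {Θ : Set (Param ι)}
  {p : Param ι → X → ℝ} {β : Param ι} {g : X → ℝ}

/-- `g` is the ratio `pₙ / p_d` of a nonnegative, possibly unnormalized, noise density `pₙ` for
which the mean-squared error can be expanded: almost everywhere, the score vanishes where `g` does,
and the first and second moments of the score weighted by `g⁻¹` exist. Since `0⁻¹ = 0`, the zeros
of `g` contribute nothing to these moments. -/
structure IsNoiseRatio (μ : Measure X) (p : Param ι → X → ℝ) (β : Param ι) (g : X → ℝ) :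
    Prop where
  nonneg : ∀ x, 0 ≤ g x
  aemeasurable : AEMeasurable g (law μ (p β))
  score_eq_zero : ∀ᵐ x ∂law μ (p β), g x = 0 → score p β x = 0
  integrable_mean : ∀ i, Integrable (fun x => (g x)⁻¹ * score p β x i) (law μ (p β))
  integrable_cov : ∀ i j,
    Integrable (fun x => (g x)⁻¹ * (score p β x i * score p β x j)) (law μ (p β))

variable [DecidableEq ι]

namespace IsModel

lemma isNoiseRatio_one (h : IsModel μ Θ p β) : IsNoiseRatio μ p β fun _ => 1 where
  nonneg _ := zero_le_one
  aemeasurable := aemeasurable_const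
  score_eq_zero := ae_of_all _ fun _ hx => absurd hx one_ne_zero
  integrable_mean i := by simpa using h.integrable_score_apply i
  integrable_cov i j := by simpa using h.integrable_score_mul_score i j

lemma norm_inv_weightOne_div_mul_score_le (h : IsModel μ Θ p β) {z : ℝ} (hz : 0 ≤ z) (i : ι)
    (x : X) :
    ‖(weightOne μ p β x / z)⁻¹ * score p β x i‖ ≤
      z * ‖Matrix.toEuclideanCLM (𝕜 := ℝ) (fisherInfo μ p β)‖ := by
  have hscore := (PiLp.norm_apply_le _ i).trans (h.norm_score_le x)
  have hw : 0 ≤ weightOne μ p β x := weightOne_nonneg x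
  have hC := norm_nonneg (Matrix.toEuclideanCLM (𝕜 := ℝ) (fisherInfo μ p β))
  generalize weightOne μ p β x = a at *
  generalize ‖Matrix.toEuclideanCLM (𝕜 := ℝ) (fisherInfo μ p β)‖ = C at *
  calc ‖(a / z)⁻¹ * score p β x i‖ = z / a * ‖score p β x i‖ := by
        rw [inv_div, norm_mul, Real.norm_of_nonneg (div_nonneg hz hw)]
    _ ≤ z / a * (C * a) := mul_le_mul_of_nonneg_left hscore (div_nonneg hz hw)
    _ = z * C * (a / a) := by ring
    _ ≤ z * C := mul_le_of_le_one_right (mul_nonneg hz hC) (div_self_le_one a)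

lemma isNoiseRatio_weightOne_div (h : IsModel μ Θ p β) :
    IsNoiseRatio μ p β fun x => weightOne μ p β x / ∫ y, weightOne μ p β y ∂law μ (p β) := by
  have := h.isProbabilityMeasure
  have hz : 0 ≤ ∫ y, weightOne μ p β y ∂law μ (p β) := integral_nonneg weightOne_nonneg
  have hmeas := h.integrable_weightOne.aemeasurable.div_const
    (∫ y, weightOne μ p β y ∂law μ (p β))
  have hmean_meas (i : ι) := (hmeas.inv.mul (h.aemeasurable_score_apply i)).aestronglyMeasurable
  have hbound (i : ι) := ae_of_all (law μ (p β)) (h.norm_inv_weightOne_div_mul_score_le hz i)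
  refine ⟨fun x => div_nonneg (weightOne_nonneg x) hz, hmeas, ?_,
    fun i => Integrable.of_bound (hmean_meas i) _ (hbound i), fun i j => ?_⟩
  · rcases hz.eq_or_lt with h0 | h0
    · filter_upwards [(integral_eq_zero_iff_of_nonneg weightOne_nonneg
        h.integrable_weightOne).1 h0.symm] with x hx _
      exact h.score_eq_zero_of_weightOne_eq_zero hx
    · filter_upwards with x hx
      exact h.score_eq_zero_of_weightOne_eq_zero ((div_eq_zero_iff.1 hx).resolve_right h0.ne')
  · simp_rw [← mul_assoc]
    exact (h.integrable_score_apply j).bdd_mul (hmean_meas i) (hbound i)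

lemma optimalNoise_eq_mul_weightOne_div (h : IsModel μ Θ p β) :
    optimalNoise μ p β =
      fun x => p β x * (weightOne μ p β x / ∫ y, weightOne μ p β y ∂law μ (p β)) := by
  ext x
  rw [optimalNoise, normalizedProduct, mul_div_assoc,
    integral_law h.integrable_data.aemeasurable h.nonneg_data]
  simp only [smul_eq_mul]

lemma tendsto_scoreMean_sub (h : IsModel μ Θ p β) (hg : IsNoiseRatio μ p β g) :
    Tendsto (fun ν : ℝ => (ν + 1) • ((scoreMean μ p β fun _ => 1) -
        scoreMean μ p β (noisePosterior ν (p β) fun x => p β x * g x))) atTop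
      (𝓝 (scoreMean μ p β fun x => (g x)⁻¹)) := by
  refine tendsto_pi_nhds.2 fun i => ?_
  simpa [scoreMean] using tendsto_add_one_mul_integral_sub_integral_noisePosterior
    (h.ae_pos.mono fun _ hx => hx.ne') hg.nonneg hg.aemeasurable (h.integrable_score_apply i)
    (hg.integrable_mean i) (hg.score_eq_zero.mono fun x hx hgx => by simp [hx hgx])

lemma tendsto_fisherInfo_sub_scoreCov (h : IsModel μ Θ p β) (hg : IsNoiseRatio μ p β g) :
    Tendsto (fun ν : ℝ => (ν + 1) • (fisherInfo μ p β -
        scoreCov μ p β (noisePosterior ν (p β) fun x => p β x * g x))) atTop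
      (𝓝 (scoreCov μ p β fun x => (g x)⁻¹)) := by
  refine tendsto_pi_nhds.2 fun i => tendsto_pi_nhds.2 fun j => ?_
  simpa [fisherInfo, scoreCov, mul_assoc] using
    tendsto_add_one_mul_integral_sub_integral_noisePosterior
      (h.ae_pos.mono fun _ hx => hx.ne') hg.nonneg hg.aemeasurable
      (h.integrable_score_mul_score i j) (hg.integrable_cov i j)
      (hg.score_eq_zero.mono fun x hx hgx => by simp [hx hgx])

lemma tendsto_mul_mse_sub_leadingError (h : IsModel μ Θ p β) (hg : IsNoiseRatio μ p β g) {T : ℝ}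
    (hT : T ≠ 0) :
    Tendsto (fun ν : ℝ => T * mse μ p β T ν (fun x => p β x * g x) - leadingError μ p β ν) atTop
      (𝓝 (∫ x, (g x)⁻¹ * weightOne μ p β x ^ 2 ∂law μ (p β) +
        meanCorrection μ p β fun x => (g x)⁻¹)) := by
  have hrate : Tendsto (fun ν : ℝ => ν + 1) atTop atTop :=
    tendsto_atTop_add_const_right _ _ tendsto_id
  have hratio : Tendsto (fun ν : ℝ => (ν + 1) / ν) atTop (𝓝 1) := by
    have hinv : Tendsto (fun ν : ℝ => 1 + ν⁻¹) atTop (𝓝 (1 + 0)) :=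
      tendsto_inv_atTop_zero.const_add 1
    rw [add_zero] at hinv
    refine hinv.congr' ?_
    filter_upwards [eventually_ne_atTop 0] with ν hν
    field_simp
  have hcov := h.tendsto_fisherInfo_sub_scoreCov hg
  have htrace := ((continuous_id.matrix_trace).tendsto _).comp
    (tendsto_smul_inv_sub_inv h.invertible_info hrate hcov)
  have hcoeff := tendsto_mul_dotProduct_self_sub hrate
    (tendsto_smul_inv_mulVec_sub h.invertible_info hrate hcov (h.tendsto_scoreMean_sub hg))
  have hlim := htrace.add (hratio.mul hcoeff)
  rw [id, trace_inv_mul_scoreCov_mul_inv hg.integrable_cov, one_mul] at hlim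
  refine hlim.congr fun ν => ?_
  rw [Function.comp_apply, id, Matrix.trace_smul, Matrix.trace_sub, mul_mse hT, leadingError]
  simp only [regressionCoeff, fisherInfo, smul_eq_mul]
  ring

lemma tendsto_mul_mse_data_sub_leadingError (h : IsModel μ Θ p β) {T : ℝ} (hT : T ≠ 0) :
    Tendsto (fun ν : ℝ => T * mse μ p β T ν (p β) - leadingError μ p β ν) atTop
      (𝓝 (∫ x, weightOne μ p β x ^ 2 ∂law μ (p β))) := by
  simpa [meanCorrection_one h.invertible_info] using
    h.tendsto_mul_mse_sub_leadingError h.isNoiseRatio_one hT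

lemma tendsto_mul_mse_optimalNoise_sub_leadingError (h : IsModel μ Θ p β) {T : ℝ} (hT : T ≠ 0) :
    Tendsto (fun ν : ℝ => T * mse μ p β T ν (optimalNoise μ p β) - leadingError μ p β ν) atTop
      (𝓝 ((∫ x, weightOne μ p β x ∂law μ (p β)) ^ 2 + meanCorrection μ p β fun x =>
        (∫ y, weightOne μ p β y ∂law μ (p β)) / weightOne μ p β x)) := by
  have hlim := h.tendsto_mul_mse_sub_leadingError h.isNoiseRatio_weightOne_div hT
  set z := ∫ y, weightOne μ p β y ∂law μ (p β)
  have hself (x : X) : z / weightOne μ p β x * weightOne μ p β x ^ 2 = z * weightOne μ p β x := by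
    rw [sq, div_mul_eq_mul_div, mul_div_assoc, mul_self_div_self]
  simp only [inv_div, hself] at hlim
  rwa [integral_const_mul, ← sq, ← h.optimalNoise_eq_mul_weightOne_div] at hlim

end IsModel

end NoiseRatio

section Normalized

variable {X ι : Type*} [MeasurableSpace X] [Fintype ι] [DecidableEq ι] {μ : Measure X}
  {Θ : Set (Param ι)} {p : Param ι → X → ℝ} {β : Param ι}

lemma IsNormalizedModel.integral_score (h : IsNormalizedModel μ Θ p β) :
    ∫ x, score p β x ∂law μ (p β) = 0 := by
  obtain ⟨g, hg, hpg⟩ := h.dominated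
  have hp := h.toIsModel.integrable_data.aemeasurable
  have hscore := (integrable_law_iff hp h.toIsModel.nonneg_data).1 h.toIsModel.integrable_score
  have hgrad : HasGradientAt (fun b => ∫ x, p b x ∂μ) (∫ x, p β x • score p β x ∂μ) β := by
    refine hasGradientAt_integral_of_dominated h.mem_nhds h.integrable hscore hg hpg ?_
    filter_upwards [h.differentiable] with x hx
    exact hasGradientAt_smul_gradient_log hx
      (eventually_of_mem h.mem_nhds fun b hb => h.nonneg b hb x)
  have hconst : HasGradientAt (fun b => ∫ x, p b x ∂μ) 0 β :=
    (hasGradientAt_const β (1 : ℝ)).congr_of_eventuallyEq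
      (eventually_of_mem h.mem_nhds h.normalized)
  rw [integral_law hp h.toIsModel.nonneg_data, hgrad.unique hconst]

lemma IsNormalizedModel.scoreMean_one (h : IsNormalizedModel μ Θ p β) :
    scoreMean μ p β (fun _ => 1) = 0 := by
  ext i
  simp only [scoreMean, one_mul]
  exact ((EuclideanSpace.proj i : Param ι →L[ℝ] ℝ).integral_comp_comm
    h.toIsModel.integrable_score).trans (by simp [h.integral_score])

end Normalized

section Unnormalized

variable {X κ : Type*} [DecidableEq κ] {q : Param κ → X → ℝ} {β : Param (κ ⊕ Unit)}

lemma log_unnormalized_add_smul_single_inr {x : X} (hx : unnormalized q β x ≠ 0) (t : ℝ) :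
    Real.log (unnormalized q (β + t • EuclideanSpace.single (Sum.inr ()) 1) x) =
      Real.log (unnormalized q β x) - t := by
  have hshift : unnormalized q (β + t • EuclideanSpace.single (Sum.inr ()) 1) x =
      unnormalized q β x / Real.exp t := by
    simp [unnormalized, Real.exp_add, div_div]
  rw [hshift, Real.log_div hx (Real.exp_ne_zero t), Real.log_exp]

variable [Fintype κ] [MeasurableSpace X] {μ : Measure X} {Θ : Set (Param (κ ⊕ Unit))}

lemma IsModel.ae_score_unnormalized_inr (h : IsModel μ Θ (unnormalized q) β) :
    ∀ᵐ x ∂law μ (unnormalized q β), score (unnormalized q) β x (Sum.inr ()) = -1 := by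
  filter_upwards [h.ae_hasGradientAt_log, h.ae_pos] with x hx hp
  have hderiv := hasDerivAt_add_smul_single_of_hasGradientAt hx (Sum.inr ())
  simp_rw [log_unnormalized_add_smul_single_inr hp.ne'] at hderiv
  exact hderiv.unique ((hasDerivAt_id 0).const_sub _)

lemma IsModel.scoreMean_unnormalized (h : IsModel μ Θ (unnormalized q) β) (w : X → ℝ) :
    scoreMean μ (unnormalized q) β w =
      scoreCov μ (unnormalized q) β w *ᵥ -Pi.single (Sum.inr ()) 1 := by
  ext i
  rw [Matrix.mulVec_neg, Matrix.mulVec_single_one, Pi.neg_apply, Matrix.col_apply, scoreMean,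
    scoreCov, Matrix.of_apply, ← integral_neg]
  refine integral_congr_ae ?_
  filter_upwards [h.ae_score_unnormalized_inr] with x hx
  rw [hx, mul_neg_one, neg_neg]

lemma IsModel.meanCorrection_unnormalized (h : IsModel μ Θ (unnormalized q) β) (w : X → ℝ) :
    meanCorrection μ (unnormalized q) β w = 0 :=
  meanCorrection_eq_zero_of_scoreMean_eq h.invertible_info
    (h.scoreMean_unnormalized _) (h.scoreMean_unnormalized w)

end Unnormalized

end NCE

theorem theorem2_general {X ι : Type*} [MeasurableSpace X] [Fintype ι] [DecidableEq ι]
    {μ : Measure X} {T : ℝ} (hT : T ≠ 0) {Θ : Set (NCE.Param ι)} {p : NCE.Param ι → X → ℝ}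
    {β : NCE.Param ι} (h : NCE.IsModel μ Θ p β) :
    Tendsto
      (fun ν : ℝ => NCE.mse μ p β T ν (p β) - NCE.mse μ p β T ν (NCE.optimalNoise μ p β))
      atTop (𝓝 (1 / T * (variance (NCE.weightOne μ p β) (NCE.law μ (p β)) -
        NCE.meanCorrection μ p β fun x =>
          (∫ y, NCE.weightOne μ p β y ∂(NCE.law μ (p β))) / NCE.weightOne μ p β x))) ∧
    (NCE.scoreMean μ p β (fun _ => 1) = 0 → Tendsto
      (fun ν : ℝ => NCE.mse μ p β T ν (NCE.optimalNoise μ p β) - NCE.mseCramerRao μ p β T ν)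
      atTop (𝓝 (1 / T * (∫ x, NCE.weightOne μ p β x ∂(NCE.law μ (p β))) ^ 2))) := by
  have := h.isProbabilityMeasure
  have hdata := h.tendsto_mul_mse_data_sub_leadingError hT
  have hopt := h.tendsto_mul_mse_optimalNoise_sub_leadingError hT
  refine ⟨?_, fun hm => ?_⟩
  · rw [variance_eq_sub h.memLp_weightOne, sub_sub]
    refine ((hdata.sub hopt).const_mul (1 / T)).congr fun ν => ?_
    field_simp
    ring
  · rw [NCE.meanCorrection_eq_zero_of_scoreMean_one_eq_zero hm, add_zero] at hopt
    refine (hopt.const_mul (1 / T)).congr fun ν => ?_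
    rw [NCE.leadingError_of_scoreMean_one_eq_zero hm, ← NCE.mul_mseCramerRao hT]
    field_simp

theorem theorem2 {X : Type*} [MeasurableSpace X] (μ : Measure X) (d : ℕ) (T : ℝ) (hT : 0 < T) :
    -- normalized models, with parameter `β = θ`
    (∀ (Θ : Set (NCE.Param (Fin d))) (p : NCE.Param (Fin d) → X → ℝ) (β : NCE.Param (Fin d)),
      NCE.IsNormalizedModel μ Θ p β →
        Tendsto
          (fun ν : ℝ => NCE.mse μ p β T ν (p β) - NCE.mse μ p β T ν (NCE.optimalNoise μ p β))
          atTop (𝓝 (1 / T * variance (NCE.weightOne μ p β) (NCE.law μ (p β)))) ∧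
        Tendsto
          (fun ν : ℝ => NCE.mse μ p β T ν (NCE.optimalNoise μ p β) - NCE.mseCramerRao μ p β T ν)
          atTop (𝓝 (1 / T * (∫ x, NCE.weightOne μ p β x ∂(NCE.law μ (p β))) ^ 2))) ∧
    -- unnormalized models, with parameter `β = (θ, c)`
    (∀ (Θ : Set (NCE.Param (Fin d ⊕ Unit))) (q : NCE.Param (Fin d) → X → ℝ)
      (β : NCE.Param (Fin d ⊕ Unit)),
      NCE.IsModel μ Θ (NCE.unnormalized q) β →
        Tendsto
          (fun ν : ℝ => NCE.mse μ (NCE.unnormalized q) β T ν (NCE.unnormalized q β) -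
            NCE.mse μ (NCE.unnormalized q) β T ν (NCE.optimalNoise μ (NCE.unnormalized q) β))
          atTop (𝓝 (1 / T * variance (NCE.weightOne μ (NCE.unnormalized q) β)
            (NCE.law μ (NCE.unnormalized q β))))) := by
  refine ⟨fun Θ p β h => ?_, fun Θ q β h => ?_⟩
  · simpa [h.scoreMean_one, NCE.meanCorrection_eq_zero_of_scoreMean_one_eq_zero h.scoreMean_one]
      using theorem2_general hT.ne' h.toIsModel
  · simpa [h.meanCorrection_unnormalized] using (theorem2_general hT.ne' h).1
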